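/- Let $k\ge 1$. A $k$-graph is a countable category $\Lambda$, with set of objects (vertices) $\Lambda^0$ and with range and source maps $r,s$ on its morphisms (paths), together with a functor $d:\Lambda\to\mathbb N^k$ (the degree) such that whenever $d(\lambda)=m+n$ there are unique paths $\mu,\nu$ with $s(\mu)=r(\nu)$, $d(\mu)=m$, $d(\nu)=n$ and $\lambda=\mu\nu$. For $v\in\Lambda^0$ and $n\in\mathbb N^k$ let $v\Lambda^n$ be the set of paths of degree $n$ with range $v$. $\Lambda$ is row-finite if every $v\Lambda^n$ is finite, and has no sources if every $v\Lambda^n$ is nonempty. Let $\Omega_k$ be the $k$-graph with vertex set $\mathbb N^k$ and exactly one path $(p,q)$, with range $p$, source $q$ and degree $q-p$, for every $p\le q$. An infinite path is a degree-preserving functor $x:\Omega_k\to\Lambda$; its range is the vertex $x(0,0)$. It is periodic if there are $p\ne q$ in $\mathbb N^k$ with $x(m+p,n+p)=x(m+q,n+q)$ for all $m\le n$ in $\mathbb N^k$, and aperiodic otherwise. $\Lambda$ is aperiodic if every vertex is the range of an aperiodic infinite path. Let $R$ be a commutative ring with $1$ and let $\Lambda^{\neq 0}$ be the set of paths of nonzero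 degree. The Kumjian-Pask algebra $\mathrm{KP}_R(\Lambda)$ of a row-finite $k$-graph $\Lambda$ without sources is the universal associative (not necessarily unital) $R$-algebra generated by elements $p_v$ ($v\in\Lambda^0$) and $s_\lambda,s_{\lambda^*}$ ($\lambda\in\Lambda^{\neq0}$) subject to the following relations: 1. the $p_v$ are mutually orthogonal idempotents; 2. for $\lambda,\mu\in\Lambda^{\neq 0}$ with $r(\mu)=s(\lambda)$: $s_\lambda s_\mu=s_{\lambda\mu}$, $s_{\mu^*}s_{\lambda^*}=s_{(\lambda\mu)^*}$, $p_{r(\lambda)}s_\lambda=s_\lambda=s_\lambda p_{s(\lambda)}$ and $p_{s(\lambda)}s_{\lambda^*}=s_{\lambda^*}=s_{\lambda^*}p_{r(\lambda)}$; 3. for $\lambda,\mu\in\Lambda^{\neq0}$ with $d(\lambda)=d(\mu)$: $s_{\lambda^*}s_\mu=\delta_{\lambda,\mu}\,p_{s(\lambda)}$; 4. for $v\in\Lambda^0$ and $n\in\mathbb N^k\setminus\{0\}$: $p_v=\sum_{\lambda\in v\Lambda^n}s_\lambda s_{\lambda^*}$. **Corollary 5.6 (Cuntz-Krieger uniqueness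 for aperiodic $\Lambda$).** Let $\Lambda$ be an aperiodic row-finite $k$-graph without sources, let $R$ be a commutative ring with $1$, let $A$ be a (not necessarily unital) associative ring, and let $\Phi:\mathrm{KP}_R(\Lambda)\to A$ be a ring homomorphism (not assumed to be $R$-linear). Then $\Phi$ is injective if and only if $\Phi(r\,p_v)\neq0$ for all $r\in R\setminus\{0\}$ and all $v\in\Lambda^0$. -/

import Mathlib

open CategoryTheory

universe u v w z

/-- A `k`-graph with vertex set `V`. The countable category is Mathlib's `Category` on `V`: a path
`λ` with source `s(λ)` and range `r(λ)` is a morphism `s(λ) ⟶ r(λ)`, so that the product `μν` of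
two paths with `s(μ) = r(ν)` is the composite `ν ≫ μ`. The degree is a functor to the one-object
category given by the additive monoid `ℕ^k`. -/
structure KGraph (k : ℕ) (V : Type u) [Category.{v} V] where
  countable_vertices : Countable V
  countable_hom : ∀ a b : V, Countable (a ⟶ b)
  /-- the degree map -/
  deg : ∀ {a b : V}, (a ⟶ b) → (Fin k → ℕ)
  deg_id : ∀ a : V, deg (𝟙 a) = 0
  deg_comp : ∀ {a b c : V} (ν : a ⟶ b) (μ : b ⟶ c), deg (ν ≫ μ) = deg μ + deg ν
  /-- Unique factorization: if `d(l) = m + n`, then `l = μν` for a unique pair `(μ, ν)` of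
  composable paths with `d(μ) = m` and `d(ν) = n`; the middle vertex belongs to the data. -/
  factorization : ∀ {a c : V} (l : a ⟶ c) (m n : Fin k → ℕ), deg l = m + n →
    ∃! f : (Σ b : V, (a ⟶ b) × (b ⟶ c)),
      deg f.2.2 = m ∧ deg f.2.1 = n ∧ f.2.1 ≫ f.2.2 = l

/-- A path: a morphism together with its source and its range. -/
@[ext]
structure KPath (V : Type u) [Category.{v} V] where
  {source : V}
  {range : V}
  hom : source ⟶ range

/-- The vertex set `ℕ^k` of the `k`-graph `Ω_k`. -/
@[ext]
structure OmegaVertex (k : ℕ) where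
  coords : Fin k → ℕ

/-- The paths of `Ω_k`: exactly one path `(p, q)`, with range `p` and source `q`, for all `p ≤ q`.
A path is a morphism from its source to its range. -/
instance (k : ℕ) : Category.{0} (OmegaVertex k) where
  Hom q p := PLift (p.coords ≤ q.coords)
  id _ := ⟨le_rfl⟩
  comp f g := ⟨g.down.trans f.down⟩

namespace KGraph

/-- The `k`-graph `Ω_k`; the degree of `(p, q)` is `q - p`. -/
def omega (k : ℕ) : KGraph k (OmegaVertex k) where
  countable_vertices := Function.Injective.countable (f := OmegaVertex.coords)
    fun _ _ h => OmegaVertex.ext h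
  countable_hom a b := inferInstanceAs (Countable (PLift _))
  deg {q p} _ := q.coords - p.coords
  deg_id a := by simp
  deg_comp {a b c} f g := by
    funext i
    have h3 : b.coords i ≤ a.coords i := f.down i
    have h4 : c.coords i ≤ b.coords i := g.down i
    simp only [Pi.sub_apply, Pi.add_apply]
    omega
  factorization {a c} l m n h := by
    have h1 : c.coords ≤ c.coords + m := fun i => by simp
    have h2 : c.coords + m ≤ a.coords := fun i => by
      have := congrFun h i
      have := l.down i
      simp only [Pi.sub_apply, Pi.add_apply] at *
      omega
    refine ⟨⟨⟨c.coords + m⟩, ⟨h2⟩, ⟨h1⟩⟩, ⟨?_, ?_, rfl⟩, ?_⟩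
    · funext i
      simp
    · funext i
      have := congrFun h i
      simp only [Pi.sub_apply, Pi.add_apply] at *
      omega
    · rintro ⟨b, f, g⟩ ⟨hg, -, -⟩
      have hb : b = ⟨c.coords + m⟩ := by
        apply OmegaVertex.ext
        funext i
        have h4 : c.coords i ≤ b.coords i := g.down i
        have h5 : b.coords i - c.coords i = m i := congrFun hg i
        simp only [Pi.add_apply]
        omega
      subst hb
      rfl

variable {k : ℕ} {V : Type u} [Category.{v} V] (G : KGraph k V)

/-- The set `aΛ^n` of paths of degree `n` with range `a`. -/
def pathsTo (a : V) (n : Fin k → ℕ) : Set (KPath V) :=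
  {l | l.range = a ∧ G.deg l.hom = n}

/-- `Λ` is row-finite: every `aΛ^n` is finite. -/
def RowFinite : Prop := ∀ (a : V) (n : Fin k → ℕ), (G.pathsTo a n).Finite

/-- `Λ` has no sources: every `aΛ^n` is nonempty. -/
def NoSources : Prop := ∀ (a : V) (n : Fin k → ℕ), (G.pathsTo a n).Nonempty

/-- An infinite path in `Λ`: a degree-preserving functor `x : Ω_k → Λ`. -/
structure InfinitePath where
  toFunctor : OmegaVertex k ⥤ V
  deg_map : ∀ {a b : OmegaVertex k} (f : a ⟶ b), G.deg (toFunctor.map f) = (omega k).deg f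

namespace InfinitePath

variable {G}

/-- The path `x(m, n)`, for `m ≤ n`. -/
def segment (x : G.InfinitePath) {m n : Fin k → ℕ} (h : m ≤ n) : KPath V :=
  ⟨x.toFunctor.map (X := ⟨n⟩) (Y := ⟨m⟩) ⟨h⟩⟩

/-- The range `r(x) = x(0, 0)`. -/
def range (x : G.InfinitePath) : V := x.toFunctor.obj ⟨0⟩

/-- `x` is periodic: `σ^p(x) = σ^q(x)` for some `p ≠ q`, where `σ^p(x)(m, n) = x(m + p, n + p)`. -/
def Periodic (x : G.InfinitePath) : Prop :=
  ∃ p q : Fin k → ℕ, p ≠ q ∧ ∀ (m n : Fin k → ℕ) (h : m ≤ n),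
    x.segment (m := m + p) (n := n + p) (add_le_add_left h p) =
      x.segment (m := m + q) (n := n + q) (add_le_add_left h q)

end InfinitePath

/-- `Λ` is aperiodic: every vertex is the range of an infinite path that is not periodic. -/
def Aperiodic : Prop := ∀ a : V, ∃ x : G.InfinitePath, x.range = a ∧ ¬ x.Periodic

/-- The set `Λ^{≠0}` of paths of nonzero degree. -/
def NonzeroPath : Type (max u v) := {l : KPath V // G.deg l.hom ≠ 0}

/-- The generators of the Kumjian-Pask algebra: the vertices, the paths of nonzero degree and the
ghost paths of nonzero degree. -/
inductive Generator : Type (max u v)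
  | vertex (a : V) : Generator
  | path (l : G.NonzeroPath) : Generator
  | ghost (l : G.NonzeroPath) : Generator

variable (R : Type w) [CommRing R]

/-- The free associative non-unital `R`-algebra on the generators. -/
abbrev FreeAlg : Type (max u v w) := MonoidAlgebra R (FreeSemigroup G.Generator)

/-- A generator as an element of the free algebra. -/
noncomputable def gen (x : G.Generator) : G.FreeAlg R :=
  MonoidAlgebra.single (FreeSemigroup.of x) 1

/-- The element `P_a`. -/
noncomputable abbrev freeP (a : V) : G.FreeAlg R := G.gen R (.vertex a)

/-- The element `S_l`. -/
noncomputable abbrev freeS (l : G.NonzeroPath) : G.FreeAlg R := G.gen R (.path l)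

/-- The element `S_{l^*}`. -/
noncomputable abbrev freeSstar (l : G.NonzeroPath) : G.FreeAlg R := G.gen R (.ghost l)

/-- A nonzero path given by a morphism. -/
def nz {a b : V} (l : a ⟶ b) (h : G.deg l ≠ 0) : G.NonzeroPath := ⟨⟨l⟩, h⟩

variable {G} in
lemma deg_comp_ne_zero {a b c : V} (ν : a ⟶ b) {μ : b ⟶ c} (h : G.deg μ ≠ 0) :
    G.deg (ν ≫ μ) ≠ 0 := by
  rw [G.deg_comp]
  exact fun e => h (add_eq_zero.mp e).1

/-- The Kumjian-Pask relations, as pairs (left-hand side, right-hand side) in the free algebra. -/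
inductive KPRel : G.FreeAlg R → G.FreeAlg R → Prop
  -- the vertices give mutually orthogonal idempotents
  | idem (a : V) : KPRel (G.freeP R a * G.freeP R a) (G.freeP R a)
  | orth (a b : V) (h : a ≠ b) : KPRel (G.freeP R a * G.freeP R b) 0
  -- multiplicativity along paths of nonzero degree
  | mul {a b c : V} (ν : a ⟶ b) (μ : b ⟶ c) (hν : G.deg ν ≠ 0) (hμ : G.deg μ ≠ 0) :
      KPRel (G.freeS R (G.nz μ hμ) * G.freeS R (G.nz ν hν))
        (G.freeS R (G.nz (ν ≫ μ) (deg_comp_ne_zero ν hμ)))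
  | mul_star {a b c : V} (ν : a ⟶ b) (μ : b ⟶ c) (hν : G.deg ν ≠ 0) (hμ : G.deg μ ≠ 0) :
      KPRel (G.freeSstar R (G.nz ν hν) * G.freeSstar R (G.nz μ hμ))
        (G.freeSstar R (G.nz (ν ≫ μ) (deg_comp_ne_zero ν hμ)))
  | range_mul (l : G.NonzeroPath) : KPRel (G.freeP R l.1.range * G.freeS R l) (G.freeS R l)
  | mul_source (l : G.NonzeroPath) : KPRel (G.freeS R l * G.freeP R l.1.source) (G.freeS R l)
  | source_mul_star (l : G.NonzeroPath) :
      KPRel (G.freeP R l.1.source * G.freeSstar R l) (G.freeSstar R l)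
  | star_mul_range (l : G.NonzeroPath) :
      KPRel (G.freeSstar R l * G.freeP R l.1.range) (G.freeSstar R l)
  -- `S_{l^*} S_m` is `P_{s(l)}` or `0` for `d(l) = d(m)`
  | star_mul_self (l : G.NonzeroPath) :
      KPRel (G.freeSstar R l * G.freeS R l) (G.freeP R l.1.source)
  | star_mul_of_ne (l m : G.NonzeroPath) (hd : G.deg l.1.hom = G.deg m.1.hom) (h : l ≠ m) :
      KPRel (G.freeSstar R l * G.freeS R m) 0
  -- `P_a` is the sum of `S_l S_{l^*}` over `F`, where `F` is the set of all paths of degree `n` with range `a`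
  | sum (a : V) (n : Fin k → ℕ) (hn : n ≠ 0) (F : Finset G.NonzeroPath)
      (hF : ∀ l : G.NonzeroPath, l ∈ F ↔ l.1 ∈ G.pathsTo a n) :
      KPRel (G.freeP R a) (∑ l ∈ F, G.freeS R l * G.freeSstar R l)

/-- The scalar multiples of the Kumjian-Pask relations. -/
inductive KPRelSMul : G.FreeAlg R → G.FreeAlg R → Prop
  | smul (r : R) {x y : G.FreeAlg R} (h : G.KPRel R x y) : KPRelSMul (r • x) (r • y)

/-- The smallest congruence of non-unital `R`-algebras that contains the Kumjian-Pask relations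
(see `kpCon_smul` for the compatibility with scalars). -/
noncomputable def kpCon : RingCon (G.FreeAlg R) := ringConGen (G.KPRelSMul R)

variable {G R} in
lemma kpCon_smul (r : R) {x y : G.FreeAlg R} (h : G.kpCon R x y) :
    G.kpCon R (r • x) (r • y) := by
  change RingConGen.Rel _ _ _ at h
  change RingConGen.Rel _ _ _
  induction h with
  | of x y h =>
    obtain ⟨t, h⟩ := h
    rw [smul_smul, smul_smul]
    exact .of _ _ (.smul (r * t) h)
  | refl x => exact .refl _
  | symm _ ih => exact .symm ih
  | trans _ _ ih1 ih2 => exact .trans ih1 ih2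
  | add _ _ ih1 ih2 => rw [smul_add, smul_add]; exact .add ih1 ih2
  | mul _ h2 ih1 _ => rw [← smul_mul_assoc, ← smul_mul_assoc]; exact .mul ih1 h2

/-- The Kumjian-Pask algebra `KP_R(Λ)`: the quotient of the free non-unital `R`-algebra on the
vertices, the paths and the ghost paths of nonzero degree by the Kumjian-Pask relations. -/
noncomputable def KP : Type (max u v w) := (G.kpCon R).Quotient

noncomputable instance : NonUnitalRing (G.KP R) :=
  inferInstanceAs (NonUnitalRing (G.kpCon R).Quotient)

/-- The class in `KP_R(Λ)` of an element of the free algebra. -/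
noncomputable def toKP (x : G.FreeAlg R) : G.KP R := RingCon.toQuotient (c := G.kpCon R) x

noncomputable instance : SMul R (G.KP R) where
  smul r := Quotient.map' (r • ·) fun _ _ h => kpCon_smul r h

noncomputable instance : Module R (G.KP R) where
  one_smul x := by
    induction x using Quotient.inductionOn' with | h x => exact congrArg (G.toKP R) (one_smul R x)
  mul_smul r t x := by
    induction x using Quotient.inductionOn' with | h x => exact congrArg (G.toKP R) (mul_smul r t x)
  smul_zero r := congrArg (G.toKP R) (smul_zero r)
  smul_add r x y := by
    induction x using Quotient.inductionOn' with | h x =>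
    induction y using Quotient.inductionOn' with | h y => exact congrArg (G.toKP R) (smul_add r x y)
  add_smul r t x := by
    induction x using Quotient.inductionOn' with | h x => exact congrArg (G.toKP R) (add_smul r t x)
  zero_smul x := by
    induction x using Quotient.inductionOn' with | h x => exact congrArg (G.toKP R) (zero_smul R x)

instance : IsScalarTower R (G.KP R) (G.KP R) where
  smul_assoc r x y := by
    induction x using Quotient.inductionOn' with | h x =>
    induction y using Quotient.inductionOn' with | h y =>
      exact congrArg (G.toKP R) (smul_mul_assoc r x y)

instance : SMulCommClass R (G.KP R) (G.KP R) where
  smul_comm r x y := by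
    induction x using Quotient.inductionOn' with | h x =>
    induction y using Quotient.inductionOn' with | h y =>
      exact congrArg (G.toKP R) (mul_smul_comm r x y).symm

/-- The generator `p_a` of `KP_R(Λ)`. -/
noncomputable def p (a : V) : G.KP R := G.toKP R (G.freeP R a)

end KGraph

/-! Suppose `Φ x = 0`. Expanding vertices by relation 4 writes `x` as a finite combination of terms
`s_α s_{β^*}` in which every `β` has the same degree (`exists_mem_pathSpanDeg`). Fix a term whose
two paths have the same source. Multiplying `x` by `s_{β^*}`'s partner `s_β` on the right kills all
terms with `β' ≠ β`, since the degrees agree. The competitors `α' ≠ α` may have other degrees.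
Aperiodicity provides a path `t`, an initial segment of an aperiodic infinite path, such that `αt`
and each `α't` are orthogonal (`exists_separating`). Hence `s_{(αt)^*} x s_{βt} = c(α,β) p_{s(t)}`.
Its image under `Φ` is zero, so `c(α,β) = 0`. Only multiplicativity of `Φ` enters, not
`R`-linearity.

For the converse, `r p_a ≠ 0` must be shown in the algebra itself (`smul_p_ne_zero`). The algebra
acts on `R`-valued functions of finite paths, modulo functions vanishing on all paths of large
degree. The quotient is what makes relation 4 hold, and the absence of sources keeps the image of `r
p_a` nonzero. -/

namespace KGraph

/-! ### Unique factorization of paths -/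

variable {k : ℕ} {V : Type u} [Category.{v} V] (G : KGraph k V)

lemma exists_eqToHom_of_deg_eq_zero {a b : V} (l : a ⟶ b) (h : G.deg l = 0) :
    ∃ e : a = b, l = eqToHom e := by
  obtain ⟨f, -, hf⟩ := G.factorization l 0 0 (by simpa using h)
  -- Both `𝟙 ≫ l` and `l ≫ 𝟙` factor `l` in degrees `0 + 0`, so uniqueness identifies them.
  have h1 := hf ⟨a, 𝟙 a, l⟩ ⟨h, G.deg_id a, Category.id_comp l⟩
  have h2 := hf ⟨b, l, 𝟙 b⟩ ⟨G.deg_id b, h, Category.comp_id l⟩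
  obtain ⟨rfl, h3⟩ := Sigma.mk.inj_iff.1 (h1.trans h2.symm)
  exact ⟨rfl, congrArg Prod.snd (eq_of_heq h3)⟩

/-- Two factorizations of the same path with left factors of the same degree agree. -/
lemma factors_eq {a b c a' b' c' : V} (ν : a ⟶ b) (μ : b ⟶ c) (ν' : a' ⟶ b') (μ' : b' ⟶ c')
    (h : (⟨ν ≫ μ⟩ : KPath V) = ⟨ν' ≫ μ'⟩) (hd : G.deg μ = G.deg μ') :
    (⟨ν⟩ : KPath V) = ⟨ν'⟩ ∧ (⟨μ⟩ : KPath V) = ⟨μ'⟩ := by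
  obtain ⟨rfl, rfl, h⟩ := KPath.mk.inj h
  have h := eq_of_heq h
  have hν : G.deg ν' = G.deg ν := by
    have h1 := congrArg G.deg h
    rw [G.deg_comp, G.deg_comp, hd] at h1
    exact (add_left_cancel h1).symm
  obtain ⟨f, -, hf⟩ := G.factorization (ν ≫ μ) _ _ (G.deg_comp ν μ)
  have h1 := hf ⟨b, ν, μ⟩ ⟨rfl, rfl, rfl⟩
  have h2 := hf ⟨b', ν', μ'⟩ ⟨hd.symm, hν, h.symm⟩
  obtain ⟨rfl, h3⟩ := Sigma.mk.inj_iff.1 (h1.trans h2.symm)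
  obtain ⟨rfl, rfl⟩ := Prod.mk.inj (eq_of_heq h3)
  exact ⟨rfl, rfl⟩

/-- A path of degree at least `n` has an initial segment of degree `n`. -/
lemma exists_factors (l : KPath V) (n : Fin k → ℕ) (h : n ≤ G.deg l.hom) :
    ∃ (b : V) (ν : l.source ⟶ b) (μ : b ⟶ l.range), G.deg μ = n ∧ ν ≫ μ = l.hom := by
  obtain ⟨f, ⟨h1, -, h2⟩, -⟩ := G.factorization l.hom n (G.deg l.hom - n)
    (add_tsub_cancel_of_le h).symm
  exact ⟨f.1, f.2.1, f.2.2, h1, h2⟩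

/-! ### The Kumjian-Pask relations, extended to paths of degree zero -/

section Algebra

variable {G} (R : Type w) [CommRing R]

lemma toKP_eq {x y : G.FreeAlg R} (h : G.KPRel R x y) : G.toKP R x = G.toKP R y :=
  (RingCon.eq _).2 (RingConGen.Rel.of _ _ (by simpa using KPRelSMul.smul 1 h))

lemma toKP_mul (x y : G.FreeAlg R) : G.toKP R (x * y) = G.toKP R x * G.toKP R y := rfl

lemma toKP_zero : G.toKP R 0 = 0 := rfl

lemma toKP_smul (r : R) (x : G.FreeAlg R) : G.toKP R (r • x) = r • G.toKP R x := rfl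

lemma toKP_add (x y : G.FreeAlg R) : G.toKP R (x + y) = G.toKP R x + G.toKP R y := rfl

lemma toKP_sum {ι : Type*} (F : Finset ι) (f : ι → G.FreeAlg R) :
    G.toKP R (∑ i ∈ F, f i) = ∑ i ∈ F, G.toKP R (f i) :=
  map_sum (AddMonoidHom.mk' (G.toKP R) (toKP_add R)) f F

variable (G)

open Classical in
/-- The element `s_l` of the Kumjian-Pask algebra, with `s_l = p_a` for the identity `l` of `a`. -/
noncomputable def s (l : KPath V) : G.KP R :=
  if h : G.deg l.hom = 0 then G.p R l.range else G.toKP R (G.freeS R ⟨l, h⟩)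

open Classical in
/-- The element `s_{l^*}` of the Kumjian-Pask algebra, with `s_{l^*} = p_a` for the identity `l`
of `a`. -/
noncomputable def sStar (l : KPath V) : G.KP R :=
  if h : G.deg l.hom = 0 then G.p R l.range else G.toKP R (G.freeSstar R ⟨l, h⟩)

variable {G}

@[simp] lemma s_id (a : V) : G.s R ⟨𝟙 a⟩ = G.p R a := dif_pos (G.deg_id a)

@[simp] lemma sStar_id (a : V) : G.sStar R ⟨𝟙 a⟩ = G.p R a := dif_pos (G.deg_id a)

lemma s_of_ne (l : KPath V) (h : G.deg l.hom ≠ 0) : G.s R l = G.toKP R (G.freeS R ⟨l, h⟩) :=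
  dif_neg h

lemma sStar_of_ne (l : KPath V) (h : G.deg l.hom ≠ 0) :
    G.sStar R l = G.toKP R (G.freeSstar R ⟨l, h⟩) :=
  dif_neg h

lemma p_mul_p_self (a : V) : G.p R a * G.p R a = G.p R a := toKP_eq R (.idem a)

lemma p_mul_p_of_ne {a b : V} (h : a ≠ b) : G.p R a * G.p R b = 0 := toKP_eq R (.orth a b h)

/-- To prove a property of all paths it suffices to treat vertices and paths of nonzero degree. -/
@[elab_as_elim]
lemma path_cases {P : KPath V → Prop} (l : KPath V) (h0 : ∀ a, P ⟨𝟙 a⟩)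
    (h1 : ∀ l, G.deg l.hom ≠ 0 → P l) : P l := by
  obtain ⟨l⟩ := l
  by_cases h : G.deg l = 0
  · obtain ⟨rfl, rfl⟩ := G.exists_eqToHom_of_deg_eq_zero l h
    exact h0 _
  · exact h1 _ h

lemma p_mul_s (l : KPath V) : G.p R l.range * G.s R l = G.s R l := by
  induction l using path_cases (G := G) with
  | h0 a => simp [p_mul_p_self]
  | h1 l h =>
    rw [s_of_ne R l h]
    exact toKP_eq R (.range_mul ⟨l, h⟩)

lemma s_mul_p (l : KPath V) : G.s R l * G.p R l.source = G.s R l := by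
  induction l using path_cases (G := G) with
  | h0 a => simp [p_mul_p_self]
  | h1 l h =>
    rw [s_of_ne R l h]
    exact toKP_eq R (.mul_source ⟨l, h⟩)

lemma p_mul_sStar (l : KPath V) : G.p R l.source * G.sStar R l = G.sStar R l := by
  induction l using path_cases (G := G) with
  | h0 a => simp [p_mul_p_self]
  | h1 l h =>
    rw [sStar_of_ne R l h]
    exact toKP_eq R (.source_mul_star ⟨l, h⟩)

lemma sStar_mul_p (l : KPath V) : G.sStar R l * G.p R l.range = G.sStar R l := by
  induction l using path_cases (G := G) with
  | h0 a => simp [p_mul_p_self]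
  | h1 l h =>
    rw [sStar_of_ne R l h]
    exact toKP_eq R (.star_mul_range ⟨l, h⟩)

lemma s_mul_s {a b c : V} (ν : a ⟶ b) (μ : b ⟶ c) :
    G.s R ⟨μ⟩ * G.s R ⟨ν⟩ = G.s R ⟨ν ≫ μ⟩ := by
  by_cases hμ : G.deg μ = 0
  · obtain ⟨rfl, rfl⟩ := G.exists_eqToHom_of_deg_eq_zero μ hμ
    simpa using p_mul_s R ⟨ν⟩
  by_cases hν : G.deg ν = 0
  · obtain ⟨rfl, rfl⟩ := G.exists_eqToHom_of_deg_eq_zero ν hν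
    simpa using s_mul_p R ⟨μ⟩
  rw [s_of_ne R ⟨μ⟩ hμ, s_of_ne R ⟨ν⟩ hν, s_of_ne R ⟨ν ≫ μ⟩ (deg_comp_ne_zero ν hμ)]
  exact toKP_eq R (.mul ν μ hν hμ)

lemma sStar_mul_sStar {a b c : V} (ν : a ⟶ b) (μ : b ⟶ c) :
    G.sStar R ⟨ν⟩ * G.sStar R ⟨μ⟩ = G.sStar R ⟨ν ≫ μ⟩ := by
  by_cases hμ : G.deg μ = 0
  · obtain ⟨rfl, rfl⟩ := G.exists_eqToHom_of_deg_eq_zero μ hμ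
    simpa using sStar_mul_p R ⟨ν⟩
  by_cases hν : G.deg ν = 0
  · obtain ⟨rfl, rfl⟩ := G.exists_eqToHom_of_deg_eq_zero ν hν
    simpa using p_mul_sStar R ⟨μ⟩
  rw [sStar_of_ne R ⟨μ⟩ hμ, sStar_of_ne R ⟨ν⟩ hν,
    sStar_of_ne R ⟨ν ≫ μ⟩ (deg_comp_ne_zero ν hμ)]
  exact toKP_eq R (.mul_star ν μ hν hμ)

lemma sStar_mul_s_self (l : KPath V) : G.sStar R l * G.s R l = G.p R l.source := by
  induction l using path_cases (G := G) with
  | h0 a => simp [p_mul_p_self]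
  | h1 l h =>
    rw [s_of_ne R l h, sStar_of_ne R l h]
    exact toKP_eq R (.star_mul_self ⟨l, h⟩)

lemma sStar_mul_s_of_ne (l m : KPath V) (hd : G.deg l.hom = G.deg m.hom) (h : l ≠ m) :
    G.sStar R l * G.s R m = 0 := by
  obtain ⟨l⟩ := l
  obtain ⟨m⟩ := m
  by_cases hm : G.deg m = 0
  · obtain ⟨rfl, rfl⟩ := G.exists_eqToHom_of_deg_eq_zero m hm
    obtain ⟨rfl, rfl⟩ := G.exists_eqToHom_of_deg_eq_zero l (hd.trans hm)
    simp only [eqToHom_refl, s_id, sStar_id]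
    refine p_mul_p_of_ne R fun e => h ?_
    subst e
    rfl
  · have hl : G.deg l ≠ 0 := fun e => hm (hd.symm.trans e)
    rw [s_of_ne R ⟨m⟩ hm, sStar_of_ne R ⟨l⟩ hl]
    exact toKP_eq R (.star_mul_of_ne ⟨⟨l⟩, hl⟩ ⟨⟨m⟩, hm⟩ hd fun e => h (congrArg Subtype.val e))

lemma s_mul_s_of_ne (l m : KPath V) (h : l.source ≠ m.range) : G.s R l * G.s R m = 0 := by
  rw [← s_mul_p R l, ← p_mul_s R m, mul_assoc, ← mul_assoc (G.p R _), p_mul_p_of_ne R h, zero_mul,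
    mul_zero]

lemma sStar_mul_sStar_of_ne (l m : KPath V) (h : l.range ≠ m.source) :
    G.sStar R l * G.sStar R m = 0 := by
  rw [← sStar_mul_p R l, ← p_mul_sStar R m, mul_assoc, ← mul_assoc (G.p R _), p_mul_p_of_ne R h,
    zero_mul, mul_zero]

lemma s_mul_sStar_of_ne (l m : KPath V) (h : l.source ≠ m.source) :
    G.s R l * G.sStar R m = 0 := by
  rw [← s_mul_p R l, ← p_mul_sStar R m, mul_assoc, ← mul_assoc (G.p R _), p_mul_p_of_ne R h, zero_mul,
    mul_zero]

lemma p_eq_sum (hfin : G.RowFinite) (a : V) (n : Fin k → ℕ) :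
    G.p R a = ∑ l ∈ (hfin a n).toFinset, G.s R l * G.sStar R l := by
  by_cases hn : n = 0
  · subst hn
    have : (hfin a 0).toFinset = {⟨𝟙 a⟩} := by
      ext ⟨l⟩
      simp only [pathsTo, Set.Finite.mem_toFinset, Set.mem_ofPred_eq, Finset.mem_singleton]
      constructor
      · rintro ⟨rfl, h⟩
        obtain ⟨rfl, rfl⟩ := G.exists_eqToHom_of_deg_eq_zero l h
        rfl
      · intro h
        obtain ⟨rfl, rfl, h⟩ := KPath.mk.inj h
        obtain rfl := eq_of_heq h
        exact ⟨rfl, G.deg_id _⟩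
    simp [this, p_mul_p_self]
  · classical
    have hne : ∀ l ∈ (hfin a n).toFinset, G.deg l.hom ≠ 0 := fun l hl => by
      rw [((hfin a n).mem_toFinset.1 hl).2]
      exact hn
    obtain ⟨F, hF, hsum⟩ : ∃ F : Finset G.NonzeroPath,
        (∀ l : G.NonzeroPath, l ∈ F ↔ l.1 ∈ G.pathsTo a n) ∧ ∀ f : KPath V → G.KP R,
          ∑ l ∈ F, f l.1 = ∑ l ∈ (hfin a n).toFinset, f l :=
      ⟨Finset.subtype (fun l : KPath V => G.deg l.hom ≠ 0) (hfin a n).toFinset,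
        fun l => Finset.mem_subtype.trans (hfin a n).mem_toFinset,
        fun f => Finset.sum_subtype_of_mem f hne⟩
    have h := toKP_eq R (KPRel.sum a n hn F hF)
    rw [toKP_sum] at h
    rw [← hsum]
    refine h.trans (Finset.sum_congr rfl fun l _ => ?_)
    rw [s_of_ne R l.1 l.2, sStar_of_ne R l.1 l.2]
    rfl

/-! ### Products of generators and the spanning set `s_α s_{β^*}` -/

/-- `s_{l^*} s_m` is `0` or a path if `d(l) ≤ d(m)`. -/
lemma sStar_mul_s_of_le (l m : KPath V) (h : G.deg l.hom ≤ G.deg m.hom) :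
    G.sStar R l * G.s R m = 0 ∨ ∃ t, G.sStar R l * G.s R m = G.s R t := by
  obtain ⟨b, ν, μ, hd, hm⟩ := G.exists_factors m _ h
  have hm' : G.s R m = G.s R ⟨μ⟩ * G.s R ⟨ν⟩ := by
    rw [s_mul_s, hm]
  by_cases e : l = ⟨μ⟩
  · subst e
    exact .inr ⟨⟨ν⟩, by rw [hm', ← mul_assoc, sStar_mul_s_self]; exact p_mul_s R ⟨ν⟩⟩
  · exact .inl (by rw [hm', ← mul_assoc, sStar_mul_s_of_ne R l ⟨μ⟩ hd.symm e, zero_mul])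

/-- `s_{m^*} s_l` is `0` or a ghost path if `d(l) ≤ d(m)`. -/
lemma sStar_mul_s_of_ge (l m : KPath V) (h : G.deg l.hom ≤ G.deg m.hom) :
    G.sStar R m * G.s R l = 0 ∨ ∃ t, G.sStar R m * G.s R l = G.sStar R t := by
  obtain ⟨b, ν, μ, hd, hm⟩ := G.exists_factors m _ h
  have hm' : G.sStar R m = G.sStar R ⟨ν⟩ * G.sStar R ⟨μ⟩ := by
    rw [sStar_mul_sStar, hm]
  by_cases e : l = ⟨μ⟩
  · subst e
    exact .inr ⟨⟨ν⟩, by rw [hm', mul_assoc, sStar_mul_s_self]; exact sStar_mul_p R ⟨ν⟩⟩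
  · exact .inl (by
      rw [hm', mul_assoc, sStar_mul_s_of_ne R ⟨μ⟩ l hd (fun h => e h.symm), mul_zero])

/-- The product of two paths is `0` or a path. -/
lemma s_mul_s_cases (l m : KPath V) :
    G.s R l * G.s R m = 0 ∨ ∃ t, G.s R l * G.s R m = G.s R t := by
  obtain ⟨l⟩ := l
  obtain ⟨m⟩ := m
  rename_i a b c d
  by_cases h : d = a
  · subst h
    exact .inr ⟨_, s_mul_s R m l⟩
  · exact .inl (s_mul_s_of_ne R _ _ fun e => h e.symm)

/-- The product of two ghost paths is `0` or a ghost path. -/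
lemma sStar_mul_sStar_cases (l m : KPath V) :
    G.sStar R l * G.sStar R m = 0 ∨ ∃ t, G.sStar R l * G.sStar R m = G.sStar R t := by
  obtain ⟨l⟩ := l
  obtain ⟨m⟩ := m
  rename_i a b c d
  by_cases h : b = c
  · subst h
    exact .inr ⟨_, sStar_mul_sStar R l m⟩
  · exact .inl (sStar_mul_sStar_of_ne R _ _ h)

variable (G) in
/-- The span of all `s_α s_{β^*}`. -/
noncomputable def pathSpan : Submodule R (G.KP R) :=
  Submodule.span R (Set.range fun i : KPath V × KPath V => G.s R i.1 * G.sStar R i.2)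

lemma mem_pathSpan (α β : KPath V) : G.s R α * G.sStar R β ∈ G.pathSpan R :=
  Submodule.subset_span ⟨(α, β), rfl⟩

lemma s_mul_mem (l : KPath V) {x : G.KP R} (hx : x ∈ G.pathSpan R) :
    G.s R l * x ∈ G.pathSpan R := by
  induction hx using Submodule.span_induction with
  | mem x h =>
    obtain ⟨⟨α, β⟩, rfl⟩ := h
    simp only [← mul_assoc]
    obtain h | ⟨t, h⟩ := s_mul_s_cases R l α <;> rw [h]
    · simp
    · exact mem_pathSpan R t β
  | zero => simp
  | add x y _ _ hx hy => rw [mul_add]; exact add_mem hx hy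
  | smul r x _ hx => rw [mul_smul_comm]; exact Submodule.smul_mem _ _ hx

/-- Inserting `p_{r(l)} = ∑ s_t s_{t^*}` with `d(t) = d(l) + d(α)` between `s_{l^*}` and `s_α` makes
`t` long enough for both: `s_{l^*} s_t` is a path or `0`, and `s_{t^*} s_α` is a ghost path or `0`.
-/
lemma sStar_mul_mem (hfin : G.RowFinite) (l : KPath V) {x : G.KP R} (hx : x ∈ G.pathSpan R) :
    G.sStar R l * x ∈ G.pathSpan R := by
  induction hx using Submodule.span_induction with
  | mem x h =>
    obtain ⟨⟨α, β⟩, rfl⟩ := h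
    have h : G.sStar R l * (G.s R α * G.sStar R β) =
        ∑ t ∈ (hfin l.range (G.deg l.hom + G.deg α.hom)).toFinset,
          (G.sStar R l * G.s R t) * ((G.sStar R t * G.s R α) * G.sStar R β) := by
      conv_lhs => rw [← sStar_mul_p, p_eq_sum R hfin l.range (G.deg l.hom + G.deg α.hom),
        Finset.mul_sum, Finset.sum_mul]
      simp only [mul_assoc]
    rw [h]
    refine sum_mem fun t ht => ?_
    have ht := ((hfin _ _).mem_toFinset.1 ht).2
    obtain h1 | ⟨t1, h1⟩ := sStar_mul_s_of_le R l t (by rw [ht]; exact le_self_add) <;> rw [h1]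
    · simp
    obtain h2 | ⟨t2, h2⟩ := sStar_mul_s_of_ge R α t (by rw [ht]; exact le_add_self) <;> rw [h2]
    · simp
    obtain h3 | ⟨t3, h3⟩ := sStar_mul_sStar_cases R t2 β <;> rw [h3]
    · simp
    · exact mem_pathSpan R _ _
  | zero => simp
  | add x y _ _ hx hy => rw [mul_add]; exact add_mem hx hy
  | smul r x _ hx => rw [mul_smul_comm]; exact Submodule.smul_mem _ _ hx

lemma p_mem (a : V) : G.p R a ∈ G.pathSpan R := by
  simpa [p_mul_p_self] using mem_pathSpan R (G := G) ⟨𝟙 a⟩ ⟨𝟙 a⟩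

lemma toKP_gen_vertex (a : V) : G.toKP R (G.gen R (.vertex a)) = G.s R ⟨𝟙 a⟩ := (s_id R a).symm

lemma toKP_gen_path (l : G.NonzeroPath) : G.toKP R (G.gen R (.path l)) = G.s R l.1 :=
  (s_of_ne R l.1 l.2).symm

lemma toKP_gen_ghost (l : G.NonzeroPath) : G.toKP R (G.gen R (.ghost l)) = G.sStar R l.1 :=
  (sStar_of_ne R l.1 l.2).symm

/-- Left multiplication suffices for spanning, because words in the generators are built by adding
letters on the left. -/
lemma gen_mul_mem (hfin : G.RowFinite) (g : G.Generator) {x : G.KP R}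
    (hx : x ∈ G.pathSpan R) : G.toKP R (G.gen R g) * x ∈ G.pathSpan R := by
  cases g with
  | vertex a => rw [toKP_gen_vertex]; exact s_mul_mem R _ hx
  | path l => rw [toKP_gen_path]; exact s_mul_mem R l.1 hx
  | ghost l => rw [toKP_gen_ghost]; exact sStar_mul_mem R hfin l.1 hx

lemma gen_mem (hfin : G.RowFinite) (g : G.Generator) :
    G.toKP R (G.gen R g) ∈ G.pathSpan R := by
  cases g with
  | vertex a => exact p_mem R a
  | path l => rw [toKP_gen_path, ← s_mul_p]; exact s_mul_mem R l.1 (p_mem R _)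
  | ghost l => rw [toKP_gen_ghost, ← sStar_mul_p]; exact sStar_mul_mem R hfin l.1 (p_mem R _)

/-- The Kumjian-Pask algebra is spanned by the elements `s_α s_{β^*}`. -/
lemma mem_pathSpan_of_rowFinite (hfin : G.RowFinite) (x : G.KP R) : x ∈ G.pathSpan R := by
  have hw : ∀ y : FreeSemigroup G.Generator,
      G.toKP R (MonoidAlgebra.single y 1) ∈ G.pathSpan R := by
    intro y
    induction y using FreeSemigroup.recOnMul with
    | ih1 g => exact gen_mem R hfin g
    | ih2 g y _ ih =>
      have : (MonoidAlgebra.single (FreeSemigroup.of g * y) 1 : G.FreeAlg R) =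
          G.gen R g * MonoidAlgebra.single y 1 := by
        rw [gen, MonoidAlgebra.single_mul_single, mul_one]
      rw [this, toKP_mul]
      exact gen_mul_mem R hfin g ih
  induction x using Quotient.inductionOn' with | h x =>
  change G.toKP R x ∈ _
  induction x using MonoidAlgebra.induction_linear with
  | zero => rw [toKP_zero]; exact zero_mem _
  | add x y hx hy => rw [toKP_add]; exact add_mem hx hy
  | single y r =>
    have : (MonoidAlgebra.single y r : G.FreeAlg R) = r • MonoidAlgebra.single y 1 := by
      simp
    rw [this, toKP_smul]
    exact Submodule.smul_mem _ _ (hw y)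

/-! ### Making the degrees of the ghost paths equal -/

variable (G) in
/-- The span of all `s_α s_{β^*}` with `d(β) = n`. -/
noncomputable def pathSpanDeg (n : Fin k → ℕ) : Submodule R (G.KP R) :=
  Submodule.span R (Set.range fun i : KPath V × {β : KPath V // G.deg β.hom = n} =>
    G.s R i.1 * G.sStar R i.2.1)

/-- Inserting `p_{s(α)} = ∑ s_t s_{t^*}` with `d(t) = n - d(β)` replaces each pair `(α, β)` by the
pairs `(αt, βt)`, and `d(βt) = n`. -/
lemma mem_pathSpanDeg (hfin : G.RowFinite) (n : Fin k → ℕ) (α β : KPath V)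
    (h : G.deg β.hom ≤ n) : G.s R α * G.sStar R β ∈ G.pathSpanDeg R n := by
  rw [← s_mul_p, p_eq_sum R hfin α.source (n - G.deg β.hom), Finset.mul_sum, Finset.sum_mul]
  refine sum_mem fun t ht => ?_
  obtain ⟨h1, h2⟩ := (hfin _ _).mem_toFinset.1 ht
  obtain ⟨α⟩ := α
  obtain ⟨β⟩ := β
  obtain ⟨t⟩ := t
  rename_i a b c d e f
  simp only at h1 h2 h
  subst h1
  rw [← mul_assoc, s_mul_s, mul_assoc]
  by_cases hc : f = c
  · subst hc
    rw [sStar_mul_sStar]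
    refine Submodule.subset_span ⟨(_, ⟨⟨t ≫ β⟩, ?_⟩), rfl⟩
    rw [G.deg_comp, h2]
    exact add_tsub_cancel_of_le h
  · rw [sStar_mul_sStar_of_ne R _ _ hc]
    simp

lemma pathSpanDeg_mono (hfin : G.RowFinite) {m n : Fin k → ℕ} (h : m ≤ n) :
    G.pathSpanDeg R m ≤ G.pathSpanDeg R n := by
  refine Submodule.span_le.2 ?_
  rintro _ ⟨⟨α, β, hβ⟩, rfl⟩
  exact mem_pathSpanDeg R hfin n α β (hβ.trans_le h)

lemma exists_mem_pathSpanDeg (hfin : G.RowFinite) (x : G.KP R) :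
    ∃ n, x ∈ G.pathSpanDeg R n := by
  have hx := mem_pathSpan_of_rowFinite R hfin x
  induction hx using Submodule.span_induction with
  | mem x h =>
    obtain ⟨⟨α, β⟩, rfl⟩ := h
    exact ⟨_, mem_pathSpanDeg R hfin _ α β le_rfl⟩
  | zero => exact ⟨0, zero_mem _⟩
  | add x y _ _ hx hy =>
    obtain ⟨m, hm⟩ := hx
    obtain ⟨n, hn⟩ := hy
    exact ⟨m ⊔ n, add_mem (pathSpanDeg_mono R hfin le_sup_left hm)
      (pathSpanDeg_mono R hfin le_sup_right hn)⟩
  | smul r x _ hx => exact ⟨hx.choose, Submodule.smul_mem _ _ hx.choose_spec⟩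

/-! ### Separating paths by aperiodicity -/

namespace InfinitePath

/-- The initial segment `x(0, n)` as a morphism. -/
def initial (x : G.InfinitePath) (n : Fin k → ℕ) : x.toFunctor.obj ⟨n⟩ ⟶ x.range :=
  x.toFunctor.map (X := ⟨n⟩) (Y := ⟨0⟩) ⟨fun _ => Nat.zero_le _⟩

lemma deg_initial (x : G.InfinitePath) (n : Fin k → ℕ) : G.deg (x.initial n) = n := by
  refine (x.deg_map _).trans ?_
  simp [omega]

lemma map_comp_initial (x : G.InfinitePath) {m n : Fin k → ℕ} (h : m ≤ n) :
    x.toFunctor.map (X := ⟨n⟩) (Y := ⟨m⟩) ⟨h⟩ ≫ x.initial m = x.initial n :=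
  (x.toFunctor.map_comp _ _).symm

end InfinitePath

/-- If `x` is not periodic, then distinct paths `α` and `β` become orthogonal once they are extended
by a sufficiently long initial segment of `x`. -/
lemma sStar_mul_s_initial (x : G.InfinitePath) (hx : ¬ x.Periodic) {b c : V} (α : x.range ⟶ b)
    (β : x.range ⟶ c) (h : (⟨α⟩ : KPath V) ≠ ⟨β⟩) :
    ∃ N, ∀ M, N ≤ M →
      G.sStar R ⟨x.initial M ≫ α⟩ * G.s R ⟨x.initial M ≫ β⟩ = 0 := by
  by_cases hd : G.deg α = G.deg β
  · refine ⟨0, fun M _ => ?_⟩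
    rw [← s_mul_s, ← sStar_mul_sStar, mul_assoc, ← mul_assoc (G.sStar R ⟨α⟩),
      sStar_mul_s_of_ne R ⟨α⟩ ⟨β⟩ hd h, zero_mul, mul_zero]
  -- The shifts `d(β)` and `d(α)` are crossed on purpose: `α x(0, n + d(β))` and `β x(0, n + d(α))`
  -- have the same degree, so they are orthogonal unless equal.
  · simp only [InfinitePath.Periodic, not_exists, not_and, not_forall] at hx
    obtain ⟨m, n, hmn, hne⟩ := hx (G.deg β) (G.deg α) (fun e => hd e.symm)
    -- This bound makes `x(0, M)` extend both `x(0, n + d(β))` and `x(0, n + d(α))`.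
    refine ⟨n + (G.deg β + G.deg α), fun M hM => ?_⟩
    have h1 : n + G.deg β ≤ M := le_trans (fun i => by simp) hM
    have h2 : n + G.deg α ≤ M := le_trans (fun i => by simp) hM
    have e1 := congrArg (· ≫ α) (x.map_comp_initial h1)
    have e2 := congrArg (· ≫ β) (x.map_comp_initial h2)
    simp only [Category.assoc] at e1 e2
    rw [← e1, ← e2, ← s_mul_s, ← sStar_mul_sStar, mul_assoc,
      ← mul_assoc (G.sStar R ⟨x.initial _ ≫ α⟩), sStar_mul_s_of_ne R, zero_mul, mul_zero]
    · simp only [G.deg_comp, InfinitePath.deg_initial]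
      abel
    · intro e
      -- If the two paths were equal, cancelling the initial parts `α x(0, m + d(β))` and `β x(0, m
      -- + d(α))`, again of equal degree, would identify the two segments that witness
      -- nonperiodicity.
      rw [← x.map_comp_initial (add_le_add_left hmn (G.deg β)),
        ← x.map_comp_initial (add_le_add_left hmn (G.deg α)), Category.assoc,
        Category.assoc] at e
      refine hne (G.factors_eq _ _ _ _ e ?_).1
      simp only [G.deg_comp, InfinitePath.deg_initial]
      abel

/-- In an aperiodic graph, a path `α` can be separated from finitely many other paths by a
path `t`. -/
lemma exists_separating (hap : G.Aperiodic) (α : KPath V) (F : Finset (KPath V)) :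
    ∃ t : KPath V, t.range = α.source ∧ ∀ β ∈ F, β ≠ α →
      (G.sStar R t * G.sStar R α) * (G.s R β * G.s R t) = 0 := by
  obtain ⟨α⟩ := α
  rename_i a b
  obtain ⟨x, rfl, hx⟩ := hap a
  have key : ∀ β : KPath V, ∃ N, ∀ M, N ≤ M → β ≠ ⟨α⟩ →
      (G.sStar R ⟨x.initial M⟩ * G.sStar R ⟨α⟩) * (G.s R β * G.s R ⟨x.initial M⟩) = 0 := by
    rintro ⟨β⟩
    rename_i c d
    by_cases hc : c = x.range
    · subst hc
      by_cases hβ : (⟨β⟩ : KPath V) = ⟨α⟩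
      · exact ⟨0, fun _ _ h => absurd hβ h⟩
      · obtain ⟨N, hN⟩ := sStar_mul_s_initial R x hx α β fun e => hβ e.symm
        refine ⟨N, fun M hM _ => ?_⟩
        rw [s_mul_s, sStar_mul_sStar]
        exact hN M hM
    · exact ⟨0, fun M _ _ => by rw [s_mul_s_of_ne R _ _ hc, mul_zero]⟩
  choose N hN using key
  -- Each separation persists for longer initial segments, so the supremum of the bounds serves all
  -- of `F` at once.
  exact ⟨⟨x.initial (F.sup N)⟩, rfl, fun β hβ => hN β _ (Finset.le_sup hβ)⟩

/-! ### Isolating one coefficient -/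

/-- A ring homomorphism that does not kill the elements `r p_a` with `r ≠ 0` is injective. -/
lemma injective_of_aperiodic (hfin : G.RowFinite) (hap : G.Aperiodic) {A : Type z}
    [NonUnitalRing A] (Φ : G.KP R →ₙ+* A)
    (hΦ : ∀ (r : R) (a : V), r ≠ 0 → Φ (r • G.p R a) ≠ 0) : Function.Injective Φ := by
  classical
  refine (injective_iff_map_eq_zero Φ).2 fun x hx => ?_
  obtain ⟨n, hn⟩ := exists_mem_pathSpanDeg R hfin x
  obtain ⟨c, rfl⟩ := (Finsupp.mem_span_range_iff_exists_finsupp).1 hn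
  refine Finset.sum_eq_zero fun i hi => ?_
  obtain ⟨α, β⟩ := i
  by_cases hs : α.source = β.1.source
  swap
  · simp only [s_mul_sStar_of_ne R _ _ hs, smul_zero]
  suffices c (α, β) = 0 by simp only [this, zero_smul]
  obtain ⟨t, ht, hsep⟩ := exists_separating R hap α (c.support.image Prod.fst)
  by_contra hc
  refine hΦ _ t.source hc ?_
  have hcalc : (G.sStar R t * G.sStar R α) *
      (c.sum fun i r => r • (G.s R i.1 * G.sStar R i.2.1)) * (G.s R β.1 * G.s R t) =
      c (α, β) • G.p R t.source := by
    rw [Finsupp.sum, Finset.mul_sum, Finset.sum_mul, Finset.sum_eq_single_of_mem _ hi]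
    · have h1 : G.sStar R t * G.sStar R α * (G.s R α * G.sStar R β.1) * (G.s R β.1 * G.s R t) =
          G.sStar R t * (G.sStar R α * G.s R α) * ((G.sStar R β.1 * G.s R β.1) * G.s R t) := by
        simp only [mul_assoc]
      simp only [mul_smul_comm, smul_mul_assoc]
      rw [h1, sStar_mul_s_self, sStar_mul_s_self, ← hs, ← ht, sStar_mul_p, p_mul_s,
        sStar_mul_s_self]
    · rintro ⟨α', β'⟩ hi' hne
      simp only [mul_smul_comm, smul_mul_assoc]
      by_cases hβ : β' = β
      · subst hβ
        have h1 : G.sStar R t * G.sStar R α * (G.s R α' * G.sStar R β'.1) *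
            (G.s R β'.1 * G.s R t) =
            G.sStar R t * G.sStar R α * (G.s R α' * ((G.sStar R β'.1 * G.s R β'.1) * G.s R t)) := by
          simp only [mul_assoc]
        rw [h1, sStar_mul_s_self, ← hs, ← ht, p_mul_s,
          hsep α' (Finset.mem_image_of_mem _ hi') fun e => hne (by rw [e]), smul_zero]
      · have h1 : G.sStar R t * G.sStar R α * (G.s R α' * G.sStar R β'.1) *
            (G.s R β.1 * G.s R t) =
            G.sStar R t * G.sStar R α * (G.s R α' * ((G.sStar R β'.1 * G.s R β.1) * G.s R t)) := by
          simp only [mul_assoc]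
        rw [h1, sStar_mul_s_of_ne R β'.1 β.1 (β'.2.trans β.2.symm)
          fun e => hβ (Subtype.ext e)]
        simp
  rw [← hcalc, map_mul, map_mul, hx, mul_zero, zero_mul]

end Algebra

/-! ### Composition of paths as a relation, free of casts between endpoints -/

/-- `κ` is the product of the paths `l` and `t`. -/
def IsProduct (l t κ : KPath V) : Prop :=
  ∃ (a b c : V) (ν : a ⟶ b) (μ : b ⟶ c), l = ⟨μ⟩ ∧ t = ⟨ν⟩ ∧ κ = ⟨ν ≫ μ⟩

namespace IsProduct

lemma exists_of_eq {l t : KPath V} (h : l.source = t.range) : ∃ κ, IsProduct l t κ := by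
  obtain ⟨l⟩ := l
  obtain ⟨t⟩ := t
  simp only at h
  subst h
  exact ⟨_, _, _, _, t, l, rfl, rfl, rfl⟩

lemma source_eq {l t κ : KPath V} (h : IsProduct l t κ) : l.source = t.range := by
  obtain ⟨a, b, c, ν, μ, rfl, rfl, rfl⟩ := h
  rfl

lemma range_eq {l t κ : KPath V} (h : IsProduct l t κ) : κ.range = l.range := by
  obtain ⟨a, b, c, ν, μ, rfl, rfl, rfl⟩ := h
  rfl

lemma deg_eq {l t κ : KPath V} (h : IsProduct l t κ) :
    G.deg κ.hom = G.deg l.hom + G.deg t.hom := by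
  obtain ⟨a, b, c, ν, μ, rfl, rfl, rfl⟩ := h
  exact G.deg_comp ν μ

lemma unique {l t κ κ' : KPath V} (h : IsProduct l t κ) (h' : IsProduct l t κ') : κ = κ' := by
  obtain ⟨a, b, c, ν, μ, rfl, rfl, rfl⟩ := h
  obtain ⟨a', b', c', ν', μ', h1, h2, rfl⟩ := h'
  obtain ⟨rfl, rfl, h1⟩ := KPath.mk.inj h1
  obtain ⟨rfl, -, h2⟩ := KPath.mk.inj h2
  obtain rfl := eq_of_heq h1
  obtain rfl := eq_of_heq h2
  rfl

lemma factors_eq {l l' t t' κ : KPath V} (h : IsProduct l t κ) (h' : IsProduct l' t' κ)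
    (hd : G.deg l.hom = G.deg l'.hom) : l = l' ∧ t = t' := by
  obtain ⟨a, b, c, ν, μ, rfl, rfl, rfl⟩ := h
  obtain ⟨a', b', c', ν', μ', rfl, rfl, h⟩ := h'
  exact (G.factors_eq ν μ ν' μ' h hd).symm

lemma comp_iff {a b c : V} (ν : a ⟶ b) (μ : b ⟶ c) (t κ : KPath V) :
    (∃ u, IsProduct ⟨μ⟩ u κ ∧ IsProduct ⟨ν⟩ t u) ↔ IsProduct ⟨ν ≫ μ⟩ t κ := by
  constructor
  · rintro ⟨u, h1, ⟨x, a', b', τ, ν', h2, rfl, rfl⟩⟩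
    obtain ⟨rfl, rfl, h2⟩ := KPath.mk.inj h2
    obtain rfl := eq_of_heq h2
    refine ⟨_, _, _, τ, ν ≫ μ, rfl, rfl, h1.unique ⟨_, _, _, τ ≫ ν, μ, rfl, rfl, ?_⟩⟩
    rw [Category.assoc]
  · rintro ⟨x, a', b', τ, l, h2, rfl, rfl⟩
    obtain ⟨rfl, rfl, h2⟩ := KPath.mk.inj h2
    obtain rfl := eq_of_heq h2
    refine ⟨⟨τ ≫ ν⟩, ⟨_, _, _, τ ≫ ν, μ, rfl, rfl, ?_⟩, ⟨_, _, _, τ, ν, rfl, rfl, rfl⟩⟩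
    rw [Category.assoc]

end IsProduct

/-! ### A representation on functions of finite paths -/

section Representation

variable (R : Type w) [CommRing R]

open Classical in
/-- The operator on functions of paths given by composition with a partial map, which is
described by its graph. -/
noncomputable def pullback (r : KPath V → KPath V → Prop) : Module.End R (KPath V → R) where
  toFun f κ := if h : ∃ τ, r κ τ then f h.choose else 0
  map_add' f g := by
    funext κ
    by_cases h : ∃ τ, r κ τ <;> simp [h]
  map_smul' c f := by
    funext κ
    by_cases h : ∃ τ, r κ τ <;> simp [h]

variable {R}

lemma pullback_eq {r : KPath V → KPath V → Prop} (hr : Relator.RightUnique r)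
    (f : KPath V → R) {κ τ : KPath V} (h : r κ τ) : pullback R r f κ = f τ := by
  have h' : ∃ τ, r κ τ := ⟨τ, h⟩
  exact (dif_pos h').trans (congrArg f (hr h'.choose_spec h))

lemma pullback_eq_zero {r : KPath V → KPath V → Prop} (f : KPath V → R) {κ : KPath V}
    (h : ∀ τ, ¬ r κ τ) : pullback R r f κ = 0 :=
  dif_neg fun h' => h _ h'.choose_spec

/-- This reduces most of the relations to identities between graphs of partial maps on paths. -/
lemma pullback_pullback {r r' r'' : KPath V → KPath V → Prop} (hr : Relator.RightUnique r)
    (hr' : Relator.RightUnique r') (f : KPath V → R)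
    (hc : ∀ κ τ, (∃ u, r κ u ∧ r' u τ) ↔ r'' κ τ) :
    pullback R r (pullback R r' f) = pullback R r'' f := by
  have hr'' : Relator.RightUnique r'' := fun κ τ τ' h h' => by
    obtain ⟨u, h1, h2⟩ := (hc _ _).2 h
    obtain ⟨u', h1', h2'⟩ := (hc _ _).2 h'
    obtain rfl := hr h1 h1'
    exact hr' h2 h2'
  funext κ
  by_cases h : ∃ u, r κ u
  · obtain ⟨u, hu⟩ := h
    rw [pullback_eq hr _ hu]
    by_cases h' : ∃ τ, r' u τ
    · obtain ⟨τ, hτ⟩ := h'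
      rw [pullback_eq hr' _ hτ, pullback_eq hr'' _ ((hc _ _).1 ⟨u, hu, hτ⟩)]
    · rw [pullback_eq_zero _ fun τ hτ => h' ⟨τ, hτ⟩, pullback_eq_zero _ fun τ hτ => ?_]
      obtain ⟨u', h1, h2⟩ := (hc _ _).2 hτ
      obtain rfl := hr hu h1
      exact h' ⟨τ, h2⟩
  · rw [pullback_eq_zero _ fun τ hτ => h ⟨τ, hτ⟩, pullback_eq_zero _ fun τ hτ => ?_]
    obtain ⟨u', h1, h2⟩ := (hc _ _).2 hτ
    exact h ⟨_, h1⟩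

variable (R)

/-- The functions that vanish on all paths of sufficiently large degree. -/
def eventuallyZero : Submodule R (KPath V → R) where
  carrier := {f | ∃ n, ∀ κ, n ≤ G.deg κ.hom → f κ = 0}
  zero_mem' := ⟨0, fun _ _ => rfl⟩
  add_mem' := by
    rintro f g ⟨m, hm⟩ ⟨n, hn⟩
    refine ⟨m ⊔ n, fun κ hκ => ?_⟩
    rw [Pi.add_apply, hm κ (le_sup_left.trans hκ), hn κ (le_sup_right.trans hκ), add_zero]
  smul_mem' := by
    rintro c f ⟨m, hm⟩
    refine ⟨m, fun κ hκ => ?_⟩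
    rw [Pi.smul_apply, hm κ hκ, smul_zero]

/-- The graph of the partial map on paths by which a generator of the Kumjian-Pask algebra acts. -/
def genRel : G.Generator → KPath V → KPath V → Prop
  | .vertex a, κ, τ => κ = τ ∧ κ.range = a
  | .path l, κ, τ => IsProduct l.1 τ κ
  | .ghost l, κ, τ => IsProduct l.1 κ τ

lemma genRel_rightUnique (g : G.Generator) : Relator.RightUnique (G.genRel g) := by
  cases g with
  | vertex a => exact fun κ τ τ' h h' => h.1.symm.trans h'.1
  | path l => exact fun κ τ τ' h h' => (h.factors_eq G h' rfl).2
  | ghost l => exact fun κ τ τ' h h' => h.unique h'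

/-- Passing from `κ` to its image lowers the degree by at most a constant `d`, so the threshold
rises by at most `d`. -/
lemma pullback_genRel_mem (g : G.Generator) {f : KPath V → R} (hf : f ∈ G.eventuallyZero R) :
    pullback R (G.genRel g) f ∈ G.eventuallyZero R := by
  obtain ⟨n, hn⟩ := hf
  obtain ⟨d, hd⟩ : ∃ d, ∀ κ τ, G.genRel g κ τ → G.deg κ.hom ≤ d + G.deg τ.hom := by
    cases g with
    | vertex a =>
      refine ⟨0, ?_⟩
      rintro κ _ ⟨rfl, -⟩
      simp
    | path l => exact ⟨G.deg l.1.hom, fun κ τ h => (h.deg_eq G).le⟩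
    | ghost l =>
      refine ⟨0, fun κ τ h => ?_⟩
      rw [h.deg_eq G, zero_add]
      exact le_add_self
  refine ⟨d + n, fun κ hκ => ?_⟩
  by_cases h : ∃ τ, G.genRel g κ τ
  · obtain ⟨τ, h⟩ := h
    rw [pullback_eq (G.genRel_rightUnique g) f h]
    exact hn τ (le_of_add_le_add_left (hκ.trans (hd κ τ h)))
  · exact pullback_eq_zero f fun τ hτ => h ⟨τ, hτ⟩

/-- The representation of the free algebra by pullbacks on functions of paths, up to functions
that vanish on all paths of large degree. -/
noncomputable def rep :
    G.FreeAlg R →ₙₐ[R] Module.End R ((KPath V → R) ⧸ G.eventuallyZero R) :=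
  MonoidAlgebra.liftMagma R (FreeSemigroup.lift fun g =>
    (G.eventuallyZero R).mapQ (G.eventuallyZero R) (pullback R (G.genRel g))
      fun _ hf => G.pullback_genRel_mem R g hf)

lemma rep_gen (g : G.Generator) (f : KPath V → R) :
    G.rep R (G.gen R g) (Submodule.Quotient.mk f) =
      Submodule.Quotient.mk (pullback R (G.genRel g) f) := by
  simp [rep, gen]

lemma rep_eq {x y : G.FreeAlg R} (h : ∀ f : KPath V → R,
    G.rep R x (Submodule.Quotient.mk f) = G.rep R y (Submodule.Quotient.mk f)) :
    G.rep R x = G.rep R y := by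
  refine LinearMap.ext fun q => ?_
  obtain ⟨f, rfl⟩ := Submodule.Quotient.mk_surjective _ q
  exact h f

lemma rep_mul_eq {g g' g'' : G.Generator}
    (hc : ∀ κ τ, (∃ u, G.genRel g κ u ∧ G.genRel g' u τ) ↔ G.genRel g'' κ τ) :
    G.rep R (G.gen R g * G.gen R g') = G.rep R (G.gen R g'') := by
  refine G.rep_eq R fun f => ?_
  rw [map_mul, Module.End.mul_apply, rep_gen, rep_gen, rep_gen,
    pullback_pullback (G.genRel_rightUnique g) (G.genRel_rightUnique g') f hc]

lemma rep_mul_eq_zero {g g' : G.Generator}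
    (hc : ∀ κ u τ, G.genRel g κ u → ¬ G.genRel g' u τ) :
    G.rep R (G.gen R g * G.gen R g') = G.rep R 0 := by
  refine G.rep_eq R fun f => ?_
  rw [map_mul, Module.End.mul_apply, rep_gen, rep_gen,
    pullback_pullback (r'' := fun _ _ => False) (G.genRel_rightUnique g)
      (G.genRel_rightUnique g') f fun κ τ => ⟨fun ⟨u, h1, h2⟩ => hc κ u τ h1 h2, False.elim⟩]
  have : pullback R (fun _ _ : KPath V => False) f = 0 :=
    funext fun κ => pullback_eq_zero f fun _ h => h
  rw [this, map_zero]
  rfl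

/-- A path `κ` with range `a` and degree at least `n` has exactly one initial segment of degree `n`,
so exactly one summand contributes, with value `f κ`. Shorter paths can violate the identity; the
quotient discards them. -/
lemma rep_sum (a : V) (n : Fin k → ℕ) (F : Finset G.NonzeroPath)
    (hF : ∀ l : G.NonzeroPath, l ∈ F ↔ l.1 ∈ G.pathsTo a n) (hn : n ≠ 0) :
    G.rep R (G.freeP R a) = G.rep R (∑ l ∈ F, G.freeS R l * G.freeSstar R l) := by
  refine G.rep_eq R fun f => ?_
  rw [map_sum, LinearMap.sum_apply]
  simp only [map_mul, Module.End.mul_apply, rep_gen]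
  rw [← Submodule.mkQ_apply]
  simp only [← Submodule.mkQ_apply]
  rw [← map_sum, Submodule.mkQ_apply, Submodule.mkQ_apply, Submodule.Quotient.eq]
  refine ⟨n, fun κ hκ => ?_⟩
  rw [Pi.sub_apply, Finset.sum_apply, sub_eq_zero]
  have hz : ∀ l ∈ F, ∀ t, IsProduct l.1 t κ → κ.range = a := fun l hl t ht => by
    rw [ht.range_eq, ((hF l).1 hl).1]
  by_cases ha : κ.range = a
  · obtain ⟨b, ν, μ, hd, hc⟩ := G.exists_factors κ n hκ
    obtain ⟨l, hl⟩ : ∃ l : G.NonzeroPath, l.1 = ⟨μ⟩ := ⟨⟨⟨μ⟩, hd.trans_ne hn⟩, rfl⟩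
    have hlF : l ∈ F := (hF l).2 (hl ▸ ⟨ha, hd⟩)
    have hp : IsProduct l.1 ⟨ν⟩ κ := ⟨_, _, _, ν, μ, hl, rfl, by rw [hc]⟩
    rw [pullback_eq (G.genRel_rightUnique (.vertex a)) f (τ := κ) ⟨rfl, ha⟩,
      Finset.sum_eq_single_of_mem l hlF]
    · rw [pullback_eq (G.genRel_rightUnique (.path l)) _ hp,
        pullback_eq (G.genRel_rightUnique (.ghost l)) _ hp]
    · intro l' hl' hne
      refine pullback_eq_zero _ fun τ hτ => hne (Subtype.ext ?_)
      exact (IsProduct.factors_eq G hτ hp (((hF l').1 hl').2.trans ((hF l).1 hlF).2.symm)).1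
  · rw [pullback_eq_zero _ fun τ hτ => ha hτ.2, Finset.sum_eq_zero]
    exact fun l hl => pullback_eq_zero _ fun τ hτ => ha (hz l hl τ hτ)

/-- The representation respects the Kumjian-Pask relations. -/
lemma rep_eq_of_rel {x y : G.FreeAlg R} (h : G.KPRel R x y) : G.rep R x = G.rep R y := by
  induction h with
  | idem a =>
    refine G.rep_mul_eq R fun κ τ => ⟨?_, fun h => ⟨κ, ⟨rfl, h.2⟩, h⟩⟩
    rintro ⟨u, ⟨rfl, -⟩, h⟩
    exact h
  | orth a b h =>
    refine G.rep_mul_eq_zero R ?_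
    rintro κ _ τ ⟨rfl, h1⟩ ⟨-, h2⟩
    exact h (h1.symm.trans h2)
  | mul ν μ hν hμ => exact G.rep_mul_eq R fun κ τ => IsProduct.comp_iff ν μ τ κ
  | mul_star ν μ hν hμ =>
    exact G.rep_mul_eq R fun κ τ =>
      (exists_congr fun u => and_comm).trans (IsProduct.comp_iff ν μ κ τ)
  | range_mul l =>
    refine G.rep_mul_eq R fun κ τ => ⟨?_, fun h => ⟨κ, ⟨rfl, IsProduct.range_eq h⟩, h⟩⟩
    rintro ⟨u, ⟨rfl, -⟩, h⟩
    exact h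
  | mul_source l =>
    refine G.rep_mul_eq R fun κ τ =>
      ⟨?_, fun h => ⟨τ, h, ⟨rfl, (IsProduct.source_eq h).symm⟩⟩⟩
    rintro ⟨u, h, ⟨rfl, -⟩⟩
    exact h
  | source_mul_star l =>
    refine G.rep_mul_eq R fun κ τ =>
      ⟨?_, fun h => ⟨κ, ⟨rfl, (IsProduct.source_eq h).symm⟩, h⟩⟩
    rintro ⟨u, ⟨rfl, -⟩, h⟩
    exact h
  | star_mul_range l =>
    refine G.rep_mul_eq R fun κ τ => ⟨?_, fun h => ⟨τ, h, ⟨rfl, IsProduct.range_eq h⟩⟩⟩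
    rintro ⟨u, h, ⟨rfl, -⟩⟩
    exact h
  | star_mul_self l =>
    refine G.rep_mul_eq R fun κ τ => ⟨?_, ?_⟩
    · rintro ⟨u, h1, h2⟩
      exact ⟨(IsProduct.factors_eq G h1 h2 rfl).2, (IsProduct.source_eq h1).symm⟩
    · rintro ⟨rfl, h⟩
      obtain ⟨u, hu⟩ := IsProduct.exists_of_eq h.symm
      exact ⟨u, hu, hu⟩
  | star_mul_of_ne l m hd h =>
    exact G.rep_mul_eq_zero R fun κ u τ h1 h2 =>
      h (Subtype.ext (IsProduct.factors_eq G h1 h2 hd).1)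
  | sum a n hn F hF => exact G.rep_sum R a n F hF hn

lemma rep_eq_of_kpCon {x y : G.FreeAlg R} (h : G.kpCon R x y) : G.rep R x = G.rep R y := by
  change RingConGen.Rel _ _ _ at h
  induction h with
  | of x y h =>
    obtain ⟨r, h⟩ := h
    rw [map_smul, map_smul, G.rep_eq_of_rel R h]
  | refl x => rfl
  | symm _ ih => exact ih.symm
  | trans _ _ ih1 ih2 => exact ih1.trans ih2
  | add _ _ ih1 ih2 => rw [map_add, map_add, ih1, ih2]
  | mul _ _ ih1 ih2 => rw [map_mul, map_mul, ih1, ih2]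

/-- In the Kumjian-Pask algebra of a graph without sources, `r p_a` is nonzero for `r ≠ 0`. -/
lemma smul_p_ne_zero (hsrc : G.NoSources) (r : R) (a : V) (hr : r ≠ 0) : r • G.p R a ≠ 0 := by
  intro h
  have h1 : G.kpCon R (r • G.freeP R a) 0 := (RingCon.eq _).1 h
  -- The constant function `1` is sent to `r` times the indicator of the paths with range `a`, and
  -- such paths exist in every degree.
  have h2 := LinearMap.congr_fun (G.rep_eq_of_kpCon R h1) (Submodule.Quotient.mk fun _ => 1)
  rw [map_smul, map_zero, LinearMap.smul_apply, rep_gen, ← Submodule.Quotient.mk_smul,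
    LinearMap.zero_apply, Submodule.Quotient.mk_eq_zero] at h2
  obtain ⟨n, hn⟩ := h2
  obtain ⟨κ, h3, h4⟩ := hsrc a n
  have h5 := hn κ h4.ge
  rw [Pi.smul_apply, pullback_eq (G.genRel_rightUnique (.vertex a)) _ (τ := κ) ⟨rfl, h3⟩] at h5
  exact hr (by simpa using h5)

end Representation

end KGraph

theorem corollary5p6 {k : ℕ} (hk : 0 < k) {V : Type u} [Category.{v} V] (G : KGraph k V)
    (hfin : G.RowFinite) (hsrc : G.NoSources) (hap : G.Aperiodic)
    (R : Type w) [CommRing R] {A : Type z} [NonUnitalRing A] (Φ : G.KP R →ₙ+* A) :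
    Function.Injective Φ ↔ ∀ (r : R) (a : V), r ≠ 0 → Φ (r • G.p R a) ≠ 0 := by
  refine ⟨fun h r a hr e => ?_, G.injective_of_aperiodic R hfin hap Φ⟩
  exact G.smul_p_ne_zero R hsrc r a hr (h (e.trans (map_zero Φ).symm))
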